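/- Let $V$ be a finite-dimensional Euclidean space with inner product $(\cdot,\cdot)$, and let $\Phi\subset V$ be a reduced crystallographic root system spanning $V$ whose reflections are orthogonal, of type $A_n$ with $n\ge 1$. Let $W$ be its Weyl group, $\Pi=\{\alpha_1,\dots,\alpha_n\}$ a system of simple roots and $\alpha_0=\sum_i m_i\alpha_i$ the corresponding highest root; a simple root $\alpha_j$ is called minuscule if $m_j=1$. Let $P^\vee=\{\omega\in V : (\omega,\alpha)\in\mathbb Z \text{ for all } \alpha\in\Phi\}$ be the coweight lattice and let $W_{\mathrm{ext}}=P^\vee\rtimes W$ be the extended affine Weyl group, i.e. the group of rigid motions $x\mapsto \gamma+wx$ of $V$ with $\gamma\in P^\vee$, $w\in W$. Let $$\mathcal A=\{x\in V : (\alpha_i,x)\ge 0 \text{ for } i=1,\dots,n,\ (\alpha_0,x)\le 1\}$$ be the fundamental alcove and $$\mathcal K=\{x\in\mathcal A : (\alpha_0+\alpha_j,x)\le 1 \text{ for all minuscule } \alpha_j\}$$ the Komrakov–Premet polytope. For a group $G$ of rigid motions of $V$ put $G_x=\{g\in G : gx=x\}$. For a polytope $\mathcal F\subset V$ and $x\in\mathcal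 F$, the regular face of $x$ is the intersection of all faces of $\mathcal F$ (including $\mathcal F$ itself) containing $x$. We say that $G$ has stratified centralizers with respect to $\mathcal F$ if $G_x=G_y$ whenever $x,y\in\mathcal F$ have the same regular face. Theorem. $W_{\mathrm{ext}}$ has stratified centralizers with respect to $\mathcal K$ if and only if $n+1$ is prime. -/

import Mathlib

namespace StratCent

/-! ### Faces and stratified centralizers -/

section Stratified

variable {V : Type*} [NormedAddCommGroup V] [InnerProductSpace ℝ V]

/-- The regular face of a point `x` of a polytope `F`: the intersection of all the faces of `F`
containing `x`. A face of `F` is the set of maximizers over `F` of a linear functional (the zero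
functional gives `F` itself). -/
def regularFace (F : Set V) (x : V) : Set V :=
  ⋂₀ {B : Set V | IsExposed ℝ F B ∧ x ∈ B}

/-- The centralizer `G_x = {g ∈ G | g x = x}` of a point in a group of Euclidean rigid motions. -/
def centralizer (G : Subgroup (V ≃ᵃⁱ[ℝ] V)) (x : V) : Subgroup (V ≃ᵃⁱ[ℝ] V) where
  carrier := {g | g ∈ G ∧ g x = x}
  mul_mem' := by
    rintro g h ⟨hg, hgx⟩ ⟨hh, hhx⟩
    exact ⟨G.mul_mem hg hh, by rw [AffineIsometryEquiv.coe_mul, Function.comp_apply, hhx, hgx]⟩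
  one_mem' := ⟨G.one_mem, rfl⟩
  inv_mem' := by
    rintro g ⟨hg, hgx⟩
    refine ⟨G.inv_mem hg, ?_⟩
    have h : (g⁻¹ * g) x = x := by rw [inv_mul_cancel]; rfl
    rwa [AffineIsometryEquiv.coe_mul, Function.comp_apply, hgx] at h

/-- `G` has stratified centralizers with respect to the polytope `F`: the centralizer in `G` of a
point of `F` depends only on the regular face of that point. -/
def HasStratifiedCentralizers (G : Subgroup (V ≃ᵃⁱ[ℝ] V)) (F : Set V) : Prop :=
  ∀ x ∈ F, ∀ y ∈ F, regularFace F x = regularFace F y → centralizer G x = centralizer G y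

end Stratified

/-! ### Root systems in a Euclidean space -/

section Roots

variable {ι V N : Type*} [NormedAddCommGroup V] [InnerProductSpace ℝ V]
  [AddCommGroup N] [Module ℝ N]

/-- The roots live in the Euclidean space `V` and the root reflections
`x ↦ x - ⟨x, α^∨⟩ α` are orthogonal, i.e. they are the orthogonal reflections in the hyperplanes
`α^⊥`, so that `⟨x, α^∨⟩ = 2 (x, α) / (α, α)`. -/
class IsEuclidean (P : RootPairing ι ℝ V N) : Prop where
  isOrthogonal_reflection (i : ι) : (innerₗ V).IsOrthogonal (P.reflection i)

/-- The coweight lattice `P^∨ = {ω ∈ V | (ω, α) ∈ ℤ for all roots α}`. -/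
def coweightLattice (P : RootPairing ι ℝ V N) : AddSubgroup V where
  carrier := {ω | ∀ i, ∃ k : ℤ, inner ℝ ω (P.root i) = k}
  add_mem' := by
    intro a b ha hb i
    obtain ⟨k, hk⟩ := ha i
    obtain ⟨l, hl⟩ := hb i
    exact ⟨k + l, by rw [inner_add_left, hk, hl]; push_cast; rfl⟩
  zero_mem' := fun i => ⟨0, by simp⟩
  neg_mem' := by
    intro a ha i
    obtain ⟨k, hk⟩ := ha i
    exact ⟨-k, by rw [inner_neg_left, hk]; push_cast; rfl⟩

theorem inner_weyl_smul (P : RootPairing ι ℝ V N) [IsEuclidean P] (g : P.weylGroup) (x y : V) :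
    inner ℝ (g • x) (g • y) = inner ℝ x y := by
  revert x y
  obtain ⟨g, hg⟩ := g
  induction hg using RootPairing.weylGroup.induction with
  | mem i =>
    intro x y
    exact IsEuclidean.isOrthogonal_reflection (P := P) i x y
  | one =>
    intro x y
    exact congrArg₂ (inner ℝ) (one_smul P.weylGroup x) (one_smul P.weylGroup y)
  | mul g₁ g₂ hg₁ hg₂ hg₁' hg₂' =>
    intro x y
    rw [← Submonoid.mk_mul_mk _ _ _ hg₁ hg₂, mul_smul, mul_smul, hg₁', hg₂']

theorem weyl_smul_mem_coweightLattice (P : RootPairing ι ℝ V N) [IsEuclidean P]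
    (g : P.weylGroup) {ω : V} (hω : ω ∈ coweightLattice P) : g • ω ∈ coweightLattice P := by
  intro i
  obtain ⟨k, hk⟩ := hω (P.weylGroupToPerm g⁻¹ i)
  refine ⟨k, ?_⟩
  rw [← hk, ← P.weylGroup_apply_root, ← inner_weyl_smul P g ω, smul_inv_smul]

/-- The extended affine Weyl group `W_ext = P^∨ ⋊ W`, as a group of rigid motions of `V`: its
elements are the maps `x ↦ γ + w x` with `γ ∈ P^∨` and `w ∈ W`. -/
def extAffineWeylGroup (P : RootPairing ι ℝ V N) [IsEuclidean P] :
    Subgroup (V ≃ᵃⁱ[ℝ] V) where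
  carrier := {g | ∃ γ ∈ coweightLattice P, ∃ w : P.weylGroup, ∀ x, g x = γ + w • x}
  mul_mem' := by
    rintro g h ⟨γ, hγ, w, hg⟩ ⟨δ, hδ, v, hh⟩
    refine ⟨γ + w • δ, add_mem hγ (weyl_smul_mem_coweightLattice P w hδ), w * v, fun x => ?_⟩
    rw [AffineIsometryEquiv.coe_mul, Function.comp_apply, hh, hg, smul_add, mul_smul, add_assoc]
  one_mem' := ⟨0, zero_mem _, 1, fun x => by
    rw [AffineIsometryEquiv.coe_one, id_eq, one_smul, zero_add]⟩
  inv_mem' := by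
    rintro g ⟨γ, hγ, w, hg⟩
    refine ⟨-(w⁻¹ • γ), neg_mem (weyl_smul_mem_coweightLattice P w⁻¹ hγ), w⁻¹, fun x => ?_⟩
    apply g.injective
    have h : g (g⁻¹ x) = x := by
      rw [← Function.comp_apply (f := g), ← AffineIsometryEquiv.coe_mul, mul_inv_cancel]; rfl
    rw [h, hg, smul_add, smul_neg, smul_inv_smul, smul_inv_smul, add_neg_cancel_left]

/-- The base `b` is of type `A_n`: for a suitable numbering of its simple roots by `1, …, n`, its
Cartan matrix is the Cartan matrix of type `A_n`. -/
def IsTypeA {P : RootPairing ι ℝ V N} [P.IsCrystallographic] (b : P.Base) (n : ℕ) : Prop :=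
  ∃ e : b.support ≃ Fin n, ∀ i j, b.cartanMatrix i j = CartanMatrix.A n (e i) (e j)

/-- The root `α_0` with index `i₀` is the highest root with respect to the base `b`: for every
root `β`, the difference `α_0 - β` is a sum of simple roots. -/
def IsHighestRoot {P : RootPairing ι ℝ V N} (b : P.Base) (i₀ : ι) : Prop :=
  ∀ k, P.root i₀ - P.root k ∈ AddSubmonoid.closure (P.root '' b.support)

/-- The fundamental alcove `{x | (α_i, x) ≥ 0 for all simple α_i, (α_0, x) ≤ 1}`, where `α_0` is
the root with index `i₀` (to be taken the highest root). -/
def alcove {P : RootPairing ι ℝ V N} (b : P.Base) (i₀ : ι) : Set V :=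
  {x | (∀ i ∈ b.support, 0 ≤ inner ℝ (P.root i) x) ∧ inner ℝ (P.root i₀) x ≤ 1}

/-- The simple root `α_j` is minuscule: in `α_0 = ∑ i, m_i α_i` one has `m_j = 1`. -/
def IsMinuscule {P : RootPairing ι ℝ V N} [P.IsRootSystem] (b : P.Base) (i₀ : ι)
    (j : b.support) : Prop :=
  b.toWeightBasis.repr (P.root i₀) j = 1

/-- The Komrakov–Premet polytope
`{x ∈ 𝒜 | (α_0 + α_j, x) ≤ 1 for all minuscule simple roots α_j}`. -/
def komrakovPremet {P : RootPairing ι ℝ V N} [P.IsRootSystem] (b : P.Base) (i₀ : ι) : Set V :=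
  {x ∈ alcove b i₀ |
    ∀ j : b.support, IsMinuscule b i₀ j → inner ℝ (P.root i₀ + P.root j) x ≤ 1}

end Roots

end StratCent

/-!
Number the simple roots as `α_0, …, α_{n-1}` along the Dynkin diagram. The linear forms
`u_0, …, u_n` with `u_k - u_{k+1} = (α_k, ·)` identify `V` with `ℝ^{n+1}` modulo the diagonal.
In these coordinates the Weyl group is the symmetric group (`exists_actsAs_weyl_smul`,
`exists_weyl_smul_actsAs`), the coweight lattice consists of the points with integral coordinate
differences, the highest root is `u_0 - u_n` (`inner_highestRoot`) and all simple roots are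
minuscule. Thus `x ↦ γ + w x` fixes `x` exactly when the permutation `σ` of `w` and the integers
`c_i` given by `γ` satisfy `u_i = c_i + u_{σ i} + d` for some constant `d`. The polytope is given by
`u_k ≥ u_{k+1}` and `t_k ≤ t_*`, where `t_k = u_k - u_{k+1}` and `t_* = 1 - (u_0 - u_n)`, and a
regular face remembers which of these inequalities are tight (`inner_eq_of_regularFace_eq`).

If `n + 1` is prime, read the `u_i` as `n + 1` points of the circle `ℝ/ℤ`, permuted by the
translation by `d`. Summing the relations gives `(n + 1) d ∈ ℤ`, so either `d` is an integer, and
then `u_i = u_{σ i}` for all `i`, or the translation has order `n + 1`, the points are equidistant,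
and all `t_k` equal `t_*` (`trivial_or_equidistant`). In the first case the condition on `γ` and `w`
involves only the vanishing of some `t_k`, in the second the regular face is a single point; so
every point with the same regular face is fixed as well (`centralizer_le_of_prime`).

If `n + 1 = a m` is a proper factorization, let the cyclic sequence `(t_*, t_0, …, t_{n-1})` have
period `a`, with the value `2c` at the multiples of `a` and `c` elsewhere. Rotation by `a` steps is
induced by a rigid motion in the extended affine Weyl group fixing this point. Raising `t_0` and
lowering `t_a` slightly does not change the regular face, but the new point is no longer fixed
(`not_hasStratifiedCentralizers_of_mul`).
-/

namespace StratCent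

/-! ### Coordinates on a root system of type `A` -/

section Fin

/-- Two families of reals with the same consecutive differences have the same differences. -/
theorem sub_eq_sub_of_castSucc_sub_succ {n : ℕ} {f g : Fin (n + 1) → ℝ}
    (h : ∀ k : Fin n, f k.castSucc - f k.succ = g k.castSucc - g k.succ) (i j : Fin (n + 1)) :
    f i - f j = g i - g j := by
  have key : ∀ i, f 0 - f i = g 0 - g i := by
    intro i
    induction i using Fin.induction with
    | zero => simp
    | succ k ih => linarith [h k]
  linarith [key i, key j]

theorem zero_sub_eq_mul_of_castSucc_sub_succ {n : ℕ} {f : Fin (n + 1) → ℝ} {δ : ℝ}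
    (h : ∀ k : Fin n, f k.castSucc - f k.succ = δ) (i : Fin (n + 1)) :
    f 0 - f i = i * δ := by
  have := sub_eq_sub_of_castSucc_sub_succ (g := fun i : Fin (n + 1) => -(i * δ))
    (fun k => by rw [h k]; simp; ring) 0 i
  simpa using this

end Fin

section Coord

variable {ι V N : Type*} [NormedAddCommGroup V] [InnerProductSpace ℝ V]
  [AddCommGroup N] [Module ℝ N] {P : RootPairing ι ℝ V N} {b : P.Base} {n : ℕ}

/-- The linear forms `u_0, …, u_n` on `V` with `u_0 = 0` and `u_k - u_{k+1} = (α_k, ·)`, the simple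
roots `α_0, …, α_{n-1}` being numbered through `e`. They identify `V` with `ℝ^{n+1}` modulo the
diagonal line, so only their differences are meaningful. -/
noncomputable def coord (e : b.support ≃ Fin n) (k : Fin (n + 1)) : V →ₗ[ℝ] ℝ :=
  -∑ i : Fin n with i.castSucc < k, innerₗ V (P.root (e.symm i))

theorem coord_castSucc_sub_succ (e : b.support ≃ Fin n) (k : Fin n) (x : V) :
    coord e k.castSucc x - coord e k.succ x = inner ℝ (P.root (e.symm k)) x := by
  have : (Finset.univ.filter fun i : Fin n => i.castSucc < k.succ) =
      insert k (Finset.univ.filter fun i : Fin n => i.castSucc < k.castSucc) := by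
    ext i
    simp only [Finset.mem_filter, Finset.mem_univ, true_and, Finset.mem_insert, Fin.lt_def,
      Fin.val_castSucc, Fin.val_succ, Fin.ext_iff]
    omega
  simp only [coord, this]
  rw [Finset.sum_insert (by simp)]
  simp

theorem coord_zero (e : b.support ≃ Fin n) (x : V) : coord e 0 x = 0 := by
  simp [coord]

/-- On the coweight lattice the coordinates themselves are integral, by the normalization
`u_0 = 0`. -/
theorem exists_coord_eq_intCast (e : b.support ≃ Fin n) {γ : V} (hγ : γ ∈ coweightLattice P)
    (k : Fin (n + 1)) : ∃ c : ℤ, coord e k γ = c := by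
  induction k using Fin.induction with
  | zero => exact ⟨0, by simp [coord_zero]⟩
  | succ k ih =>
    obtain ⟨c, hc⟩ := ih
    obtain ⟨m, hm⟩ := hγ (e.symm k)
    refine ⟨c - m, ?_⟩
    have := coord_castSucc_sub_succ e k γ
    rw [real_inner_comm, hm] at this
    push_cast
    linarith

section RootSystem

variable [P.IsRootSystem]

/-- The coordinate differences separate the points of `V`. -/
theorem eq_of_coord_sub_eq (e : b.support ≃ Fin n) {x y : V}
    (h : ∀ i j, coord e i x - coord e j x = coord e i y - coord e j y) : x = y := by
  refine InnerProductSpace.ext_inner_left_basis b.toWeightBasis fun i => ?_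
  obtain ⟨k, rfl⟩ := e.symm.surjective i
  rw [b.toWeightBasis_apply, ← coord_castSucc_sub_succ, ← coord_castSucc_sub_succ, h]

theorem exists_coord_sub_eq [FiniteDimensional ℝ V] (e : b.support ≃ Fin n)
    (f : Fin (n + 1) → ℝ) : ∃ x : V, ∀ i j, coord e i x - coord e j x = f i - f j := by
  let l : V →ₗ[ℝ] ℝ :=
    b.toWeightBasis.constr ℝ fun i => f (e i).castSucc - f (e i).succ
  refine ⟨(InnerProductSpace.toDual ℝ V).symm l.toContinuousLinearMap,
    sub_eq_sub_of_castSucc_sub_succ fun k => ?_⟩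
  rw [coord_castSucc_sub_succ, real_inner_comm, InnerProductSpace.toDual_symm_apply,
    LinearMap.coe_toContinuousLinearMap', ← b.toWeightBasis_apply, Module.Basis.constr_basis]
  simp

end RootSystem

end Coord

/-! ### The Weyl group as the symmetric group on the coordinates -/

section Weyl

variable {ι V N : Type*} [NormedAddCommGroup V] [InnerProductSpace ℝ V]
  [AddCommGroup N] [Module ℝ N] {P : RootPairing ι ℝ V N} {b : P.Base} {n : ℕ}

theorem inner_reflection_comm [IsEuclidean P] (i : ι) (x y : V) :
    inner ℝ (P.reflection i x) y = inner ℝ x (P.reflection i y) := by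
  have h := IsEuclidean.isOrthogonal_reflection (P := P) i x (P.reflection i y)
  simp only [innerₗ_apply_apply] at h
  rw [← h, P.reflection_same]

/-- The map `f` acts on the coordinate differences as the permutation `σ`. -/
def ActsAs (e : b.support ≃ Fin n) (f : V → V) (σ : Equiv.Perm (Fin (n + 1))) : Prop :=
  ∀ x i j, coord e i (f x) - coord e j (f x) = coord e (σ i) x - coord e (σ j) x

theorem ActsAs.comp {e : b.support ≃ Fin n} {f g : V → V} {σ τ : Equiv.Perm (Fin (n + 1))}
    (hf : ActsAs e f σ) (hg : ActsAs e g τ) : ActsAs e (f ∘ g) (τ * σ) := fun x i j => by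
  rw [Function.comp_apply, hf, hg]; rfl

theorem actsAs_reflection_simple [P.IsCrystallographic] [IsEuclidean P] {e : b.support ≃ Fin n}
    (he : ∀ i j, b.cartanMatrix i j = CartanMatrix.A n (e i) (e j)) (m : Fin n) :
    ActsAs e (P.reflection (e.symm m)) (Equiv.swap m.castSucc m.succ) := by
  intro x
  refine sub_eq_sub_of_castSucc_sub_succ
    (g := fun i => coord e (Equiv.swap m.castSucc m.succ i) x) fun k => ?_
  have hA : P.pairing (e.symm k) (e.symm m) = (CartanMatrix.A n k m : ℤ) := by
    have := he (e.symm k) (e.symm m)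
    rw [e.apply_symm_apply, e.apply_symm_apply] at this
    rw [← this]
    exact (b.algebraMap_cartanMatrixIn_apply ℤ _ _).symm
  rw [coord_castSucc_sub_succ, ← inner_reflection_comm, P.reflection_apply_root, hA,
    inner_sub_left, real_inner_smul_left, ← coord_castSucc_sub_succ e k,
    ← coord_castSucc_sub_succ e m]
  simp only [CartanMatrix.A, Matrix.of_apply, Equiv.swap_apply_def]
  obtain h | h | h | h : k = m ∨ k.val + 1 = m.val ∨ m.val + 1 = k.val ∨
      (k ≠ m ∧ k.val + 1 ≠ m.val ∧ m.val + 1 ≠ k.val) := by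
    by_cases k = m <;> grind
  · subst h
    simp [Fin.ext_iff]
    ring
  · have h1 : k.succ = m.castSucc := by simp [Fin.ext_iff, h]
    have h2 : k ≠ m := by grind
    have h3 : k.castSucc ≠ m.castSucc := by grind
    have h4 : k.castSucc ≠ m.succ := by grind
    simp [h, h1, h2, h3, h4]
  · have h1 : k.castSucc = m.succ := by simp [Fin.ext_iff, h]
    have h2 : k ≠ m := by grind
    have h3 : k.succ ≠ m.castSucc := by grind
    have h4 : k.succ ≠ m.succ := by grind
    have h5 : m.succ ≠ m.castSucc := by grind
    simp [h, h1, h2, h3, h4, h5]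
  · obtain ⟨h1, h2, h3⟩ := h
    have h4 : k.castSucc ≠ m.castSucc := by simpa using h1
    have h5 : k.castSucc ≠ m.succ := by grind
    have h6 : k.succ ≠ m.castSucc := by grind
    have h7 : k.succ ≠ m.succ := by grind
    simp [h1, h2, h3, h4, h5, h6, h7]

/-- Every root is a difference of two coordinates, and its reflection permutes the coordinates.
Both facts pass from a root to its image under a simple reflection. -/
theorem root_eq_coord_sub_and_actsAs_reflection [Finite ι] [P.IsCrystallographic] [P.IsReduced]
    [IsEuclidean P] {e : b.support ≃ Fin n}
    (he : ∀ i j, b.cartanMatrix i j = CartanMatrix.A n (e i) (e j)) (r : ι) :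
    (∃ p q, ∀ x, inner ℝ (P.root r) x = coord e p x - coord e q x) ∧
      ∃ σ, ActsAs e (P.reflection r) σ := by
  refine b.induction_reflect r
    (p := fun r => (∃ p q, ∀ x, inner ℝ (P.root r) x = coord e p x - coord e q x) ∧
      ∃ σ, ActsAs e (P.reflection r) σ) ?_ ?_ ?_
  · rintro i ⟨⟨p, q, h⟩, σ, hσ⟩
    refine ⟨⟨q, p, fun x => ?_⟩, σ * σ * σ, ?_⟩
    · rw [P.root_reflectionPerm, P.reflection_apply_self, inner_neg_left, h, neg_sub]
    · rw [P.reflection_reflectionPerm]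
      exact (hσ.comp hσ).comp hσ
  · intro i hi
    obtain ⟨k, hk⟩ := e.symm.surjective ⟨i, hi⟩
    obtain rfl : (e.symm k : ι) = i := by rw [hk]
    exact ⟨⟨k.castSucc, k.succ, fun x => (coord_castSucc_sub_succ e k x).symm⟩, _,
      actsAs_reflection_simple he k⟩
  · rintro i j ⟨⟨p, q, h⟩, σ, hσ⟩ hj
    obtain ⟨k, hk⟩ := e.symm.surjective ⟨j, hj⟩
    obtain rfl : (e.symm k : ι) = j := by rw [hk]
    have hτ := actsAs_reflection_simple he k
    refine ⟨⟨Equiv.swap k.castSucc k.succ p, Equiv.swap k.castSucc k.succ q, fun x => ?_⟩,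
      Equiv.swap k.castSucc k.succ * (σ * Equiv.swap k.castSucc k.succ), ?_⟩
    · rw [P.root_reflectionPerm, inner_reflection_comm, h, hτ]
    · rw [P.reflection_reflectionPerm]
      exact (hτ.comp hσ).comp hτ

theorem exists_actsAs_weyl_smul [Finite ι] [P.IsCrystallographic] [P.IsReduced]
    [IsEuclidean P] {e : b.support ≃ Fin n}
    (he : ∀ i j, b.cartanMatrix i j = CartanMatrix.A n (e i) (e j)) (w : P.weylGroup) :
    ∃ σ, ActsAs e (w • · : V → V) σ := by
  obtain ⟨w, hw⟩ := w
  induction hw using RootPairing.weylGroup.induction with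
  | mem i => exact (root_eq_coord_sub_and_actsAs_reflection he i).2
  | one => exact ⟨1, fun x i j => by simp [Subgroup.mk_smul]⟩
  | mul g₁ g₂ hg₁ hg₂ h₁ h₂ =>
    obtain ⟨σ, hσ⟩ := h₁
    obtain ⟨τ, hτ⟩ := h₂
    exact ⟨τ * σ, hσ.comp hτ⟩

/-- Every permutation of the coordinates is the action of an element of the Weyl group, because the
simple reflections act as the adjacent transpositions. -/
theorem exists_weyl_smul_actsAs [P.IsCrystallographic]
    [IsEuclidean P] {e : b.support ≃ Fin n}
    (he : ∀ i j, b.cartanMatrix i j = CartanMatrix.A n (e i) (e j))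
    (σ : Equiv.Perm (Fin (n + 1))) : ∃ w : P.weylGroup, ActsAs e (w • · : V → V) σ := by
  have hσ : σ ∈ Submonoid.closure
      (Set.range fun i : Fin n => Equiv.swap i.castSucc i.succ) := by
    rw [Equiv.Perm.mclosure_swap_castSucc_succ]; trivial
  induction hσ using Submonoid.closure_induction with
  | mem σ h =>
    obtain ⟨k, rfl⟩ := h
    exact ⟨RootPairing.weylGroup.ofIdx P (e.symm k), actsAs_reflection_simple he k⟩
  | one => exact ⟨1, fun x i j => by simp⟩
  | mul σ τ _ _ h₁ h₂ =>
    obtain ⟨w, hw⟩ := h₁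
    obtain ⟨v, hv⟩ := h₂
    refine ⟨v * w, ?_⟩
    simpa only [Function.comp_def, ← mul_smul] using hv.comp hw

/-- A vector on which the coordinate differences are integral lies in the coweight lattice. -/
theorem mem_coweightLattice_of_coord_sub [Finite ι] [P.IsCrystallographic] [P.IsReduced]
    [IsEuclidean P] {e : b.support ≃ Fin n}
    (he : ∀ i j, b.cartanMatrix i j = CartanMatrix.A n (e i) (e j)) {γ : V}
    (hγ : ∀ i j, ∃ c : ℤ, coord e i γ - coord e j γ = c) : γ ∈ coweightLattice P := by
  intro r
  obtain ⟨p, q, h⟩ := (root_eq_coord_sub_and_actsAs_reflection he r).1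
  rw [real_inner_comm, h]
  exact hγ p q

end Weyl

/-! ### The highest root and the Komrakov–Premet polytope in coordinates -/

section Highest

variable {ι V N : Type*} [Finite ι] [NormedAddCommGroup V] [InnerProductSpace ℝ V]
  [FiniteDimensional ℝ V]
  [AddCommGroup N] [Module ℝ N] {P : RootPairing ι ℝ V N} [P.IsRootSystem]
  [P.IsCrystallographic] [P.IsReduced] [IsEuclidean P] {b : P.Base} {n : ℕ}

theorem inner_highestRoot {e : b.support ≃ Fin n}
    (he : ∀ i j, b.cartanMatrix i j = CartanMatrix.A n (e i) (e j)) (hn : 1 ≤ n) {i₀ : ι}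
    (hi₀ : IsHighestRoot b i₀) (x : V) :
    inner ℝ (P.root i₀) x = coord e 0 x - coord e (Fin.last n) x := by
  -- The functional `u_0 - u_n` is a root, being conjugate to the first simple root.
  obtain ⟨r, hr⟩ : ∃ r, ∀ x, inner ℝ (P.root r) x = coord e 0 x - coord e (Fin.last n) x := by
    obtain ⟨m, rfl⟩ : ∃ m, n = m + 1 := ⟨n - 1, by omega⟩
    let s : Fin (m + 1 + 1) := (0 : Fin (m + 1)).succ
    obtain ⟨w, hw⟩ := exists_weyl_smul_actsAs he (Equiv.swap s (Fin.last (m + 1)))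
    refine ⟨P.weylGroupToPerm w⁻¹ (e.symm 0), fun x => ?_⟩
    rw [← P.weylGroup_apply_root, ← inner_weyl_smul P w, smul_inv_smul,
      ← coord_castSucc_sub_succ, hw, Equiv.swap_apply_left, Equiv.swap_apply_of_ne_of_ne]
    · rfl
    · simp [s]
    · simp [Fin.ext_iff]
  obtain ⟨p, q, hpq⟩ := (root_eq_coord_sub_and_actsAs_reflection he i₀).1
  -- At the point where all simple roots take the value `1`, a root `u_p - u_q` takes the value
  -- `q - p`, which is at most `n`, with equality only for `u_0 - u_n`.
  obtain ⟨ρ, hρ⟩ := exists_coord_sub_eq e (fun k : Fin (n + 1) => -(k : ℝ))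
  have hpos : ∀ v ∈ AddSubmonoid.closure (P.root '' b.support), 0 ≤ inner ℝ v ρ := by
    intro v hv
    induction hv using AddSubmonoid.closure_induction with
    | mem v h =>
      obtain ⟨i, hi, rfl⟩ := h
      obtain ⟨k, hk⟩ := e.symm.surjective ⟨i, hi⟩
      obtain rfl : (e.symm k : ι) = i := by rw [hk]
      rw [← coord_castSucc_sub_succ, hρ]
      simp
    | zero => simp
    | add v w _ _ hv hw => rw [inner_add_left]; exact add_nonneg hv hw
  have h := hpos _ (hi₀ r)
  rw [inner_sub_left, hpq, hr, hρ, hρ] at h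
  have h' : (n : ℝ) + p ≤ q := by simpa [add_comm, le_sub_iff_add_le] using h
  have h'' : n + (p : ℕ) ≤ q := by exact_mod_cast h'
  have hp : p = 0 := Fin.ext (by rw [Fin.val_zero]; omega)
  have hq : q = Fin.last n := Fin.ext (by rw [Fin.val_last]; omega)
  rw [hpq, hp, hq]

theorem isMinuscule_of_cartanMatrix_A {e : b.support ≃ Fin n}
    (he : ∀ i j, b.cartanMatrix i j = CartanMatrix.A n (e i) (e j)) (hn : 1 ≤ n) {i₀ : ι}
    (hi₀ : IsHighestRoot b i₀) (j : b.support) : IsMinuscule b i₀ j := by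
  have h : P.root i₀ = ∑ k, P.root (e.symm k) := by
    refine ext_inner_right ℝ fun x => ?_
    rw [inner_highestRoot he hn hi₀, sum_inner]
    simp only [← coord_castSucc_sub_succ]
    have h := Fin.sum_univ_castSucc fun k => coord e k x
    rw [Fin.sum_univ_succ] at h
    rw [Finset.sum_sub_distrib]
    linarith
  classical
  rw [IsMinuscule, h]
  simp only [map_sum, b.toWeightBasis_repr_root, Finsupp.coe_finsetSum, Finset.sum_apply,
    Finsupp.single_apply, Equiv.symm_apply_eq]
  simp

theorem mem_komrakovPremet_iff {e : b.support ≃ Fin n}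
    (he : ∀ i j, b.cartanMatrix i j = CartanMatrix.A n (e i) (e j)) (hn : 1 ≤ n) {i₀ : ι}
    (hi₀ : IsHighestRoot b i₀) (x : V) :
    x ∈ komrakovPremet b i₀ ↔ ∀ k : Fin n, 0 ≤ coord e k.castSucc x - coord e k.succ x ∧
      coord e 0 x - coord e (Fin.last n) x + (coord e k.castSucc x - coord e k.succ x) ≤ 1 := by
  constructor
  · rintro ⟨⟨h1, -⟩, h2⟩ k
    have h3 := h2 (e.symm k) (isMinuscule_of_cartanMatrix_A he hn hi₀ _)
    rw [inner_add_left, inner_highestRoot he hn hi₀] at h3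
    rw [coord_castSucc_sub_succ]
    exact ⟨h1 _ (e.symm k).2, h3⟩
  · intro h
    simp only [coord_castSucc_sub_succ] at h
    have h0 := h ⟨0, hn⟩
    refine ⟨⟨fun i hi => ?_, ?_⟩, fun j _ => ?_⟩
    · simpa using (h (e ⟨i, hi⟩)).1
    · rw [inner_highestRoot he hn hi₀]
      linarith [h0.1, h0.2]
    · rw [inner_add_left, inner_highestRoot he hn hi₀]
      simpa using (h (e j)).2

end Highest

/-! ### Regular faces -/

section Faces

variable {V : Type*} [NormedAddCommGroup V] [InnerProductSpace ℝ V]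

/-- If an inequality valid on `F` is tight at `x`, it is tight at every point with the same regular
face, because it cuts out an exposed face. -/
theorem inner_eq_of_regularFace_eq {F : Set V} {v x y : V} {c : ℝ}
    (hF : ∀ z ∈ F, inner ℝ v z ≤ c) (hx : x ∈ F) (hxc : inner ℝ v x = c) (hy : y ∈ F)
    (h : regularFace F x = regularFace F y) : inner ℝ v y = c := by
  have hyx : y ∈ regularFace F x := by
    rw [h]
    exact Set.mem_sInter.mpr fun B hB => hB.2
  have hB := Set.mem_sInter.mp hyx {z ∈ F | ∀ w ∈ F, inner ℝ v w ≤ inner ℝ v z}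
    ⟨fun _ => ⟨innerSL ℝ v, by simp⟩, hx, fun w hw => (hF w hw).trans hxc.ge⟩
  exact le_antisymm (hF y hy) (hxc.ge.trans (hB.2 x hx))

/-- Every face containing `x` contains `y` when the segment from `y` to `x` can be prolonged beyond
`x` inside `F`. -/
theorem regularFace_subset_of_mem {F : Set V} {x z : V} (hy : x + z ∈ F) (hy' : x - z ∈ F) :
    regularFace F (x + z) ⊆ regularFace F x := by
  rintro p hp B ⟨hB, hxB⟩
  refine hp B ⟨hB, ?_⟩
  obtain ⟨l, rfl⟩ := hB ⟨x, hxB⟩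
  refine ⟨hy, fun w hw => (hxB.2 w hw).trans ?_⟩
  have h := hxB.2 _ hy'
  rw [map_sub] at h
  rw [map_add]
  linarith

theorem regularFace_eq_of_mem {F : Set V} {x z : V} (h' : x - z ∈ F) (h₀ : x ∈ F)
    (h₁ : x + z ∈ F) (h₂ : x + z + z ∈ F) : regularFace F x = regularFace F (x + z) := by
  refine Set.Subset.antisymm ?_ (regularFace_subset_of_mem h₁ h')
  have := regularFace_subset_of_mem (F := F) (x := x + z) (z := -z) (by simpa using h₀)
    (by simpa using h₂)
  simpa using this

end Faces

/-! ### Periodic configurations of `p` points on the circle -/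

section Circle

/-- Suppose that a translation by `d` permutes the `n + 1` points `u_i` of the circle `ℝ/ℤ`, that
`n + 1` is prime and that the `u_i` decrease inside a window of length less than `1`. Either the
translation is trivial, or it has order `n + 1`, so that the points form one orbit and are
equidistant. -/
theorem trivial_or_equidistant {n : ℕ} (hp : (n + 1).Prime) {u : Fin (n + 1) → ℝ}
    (hu : Antitone u) (hlast : u 0 - u (Fin.last n) < 1) {σ : Equiv.Perm (Fin (n + 1))}
    {c : Fin (n + 1) → ℤ} {d : ℝ} (h : ∀ i, u i = c i + u (σ i) + d) :
    (∀ i, u i = u (σ i) ∧ c i + d = 0) ∨ ∀ i : Fin (n + 1), (n + 1) * (u 0 - u i) = i := by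
  have hwin : ∀ i j, u i - u j < 1 := fun i j => by
    linarith [hu (Fin.zero_le i), hu (Fin.le_last j)]
  -- Summing the relations over `i` shows that `(n + 1) d` is an integer `m`.
  obtain ⟨m, hm⟩ : ∃ m : ℤ, (n + 1) * d = m := by
    refine ⟨-∑ i, c i, ?_⟩
    have h1 := Finset.sum_congr rfl fun i (_ : i ∈ Finset.univ) => h i
    rw [Finset.sum_add_distrib, Finset.sum_add_distrib, Equiv.sum_comp σ u] at h1
    simp at h1
    push_cast
    linarith
  have hn : (n + 1 : ℝ) ≠ 0 := by positivity
  have hpZ : Prime ((n + 1 : ℕ) : ℤ) := Nat.prime_iff_prime_int.mp hp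
  by_cases hdvd : ((n + 1 : ℕ) : ℤ) ∣ m
  · left
    obtain ⟨D, rfl⟩ := hdvd
    have hD : d = D := by
      push_cast at hm
      exact mul_left_cancel₀ hn hm
    intro i
    have h1 := h i
    have h2 := hwin i (σ i)
    have h3 := hwin (σ i) i
    have h4 : c i + D < 1 := by
      have : (c i : ℝ) + D < 1 := by linarith
      exact_mod_cast this
    have h5 : -1 < c i + D := by
      have : (-1 : ℝ) < c i + D := by linarith
      exact_mod_cast this
    have h6 : c i + D = 0 := by omega
    have h7 : (c i : ℝ) + d = 0 := by rw [hD]; exact_mod_cast h6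
    exact ⟨by linarith, h7⟩
  · right
    have hiter : ∀ k : ℕ, ∃ z : ℤ, u 0 = u ((σ ^ k) 0) + z + k * d := by
      intro k
      induction k with
      | zero => exact ⟨0, by simp⟩
      | succ k ih =>
        obtain ⟨z, hz⟩ := ih
        refine ⟨z + c ((σ ^ k) 0), ?_⟩
        rw [hz, h ((σ ^ k) 0), pow_succ', Equiv.Perm.mul_apply]
        push_cast
        ring
    have hmod : ∀ k l : Fin (n + 1), ((n + 1 : ℕ) : ℤ) ∣ (k - l) * m → k = l := by
      intro k l hkl
      have h1 := (hpZ.dvd_or_dvd hkl).resolve_right hdvd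
      have h2 := Int.eq_zero_of_abs_lt_dvd h1 (by rw [abs_lt]; constructor <;> omega)
      ext
      omega
    -- Hence the points `σ^k 0` for `k ≤ n` are distinct, and they are all the indices.
    have hsurj : Function.Surjective fun k : Fin (n + 1) => (σ ^ (k : ℕ)) 0 := by
      refine Finite.surjective_of_injective fun k l hkl => hmod k l ?_
      obtain ⟨z, hz⟩ := hiter k
      obtain ⟨z', hz'⟩ := hiter l
      rw [hkl] at hz
      refine ⟨z' - z, ?_⟩
      have : ((k : ℝ) - l) * ((n + 1) * d) = (n + 1) * (z' - z) := by
        linear_combination (n + 1 : ℝ) * (hz' - hz)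
      rw [hm] at this
      exact_mod_cast this
    have hN : ∀ i, ∃ N : Fin (n + 1), (n + 1) * (u 0 - u i) = N ∧
        ∃ k : Fin (n + 1), (σ ^ (k : ℕ)) 0 = i ∧ ((n + 1 : ℕ) : ℤ) ∣ N - k * m := by
      intro i
      obtain ⟨k, rfl⟩ := hsurj i
      obtain ⟨z, hz⟩ := hiter k
      have h1 : (n + 1) * (u 0 - u ((σ ^ (k : ℕ)) 0)) = (((n + 1) * z + k * m : ℤ) : ℝ) := by
        push_cast
        rw [← hm]
        linear_combination (n + 1 : ℝ) * hz
      have h2 : 0 ≤ (n + 1) * z + k * m := by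
        have : (0 : ℝ) ≤ (((n + 1) * z + k * m : ℤ) : ℝ) := by
          rw [← h1]
          exact mul_nonneg (by positivity) (sub_nonneg.mpr (hu (Fin.zero_le _)))
        exact_mod_cast this
      have h3 : (n + 1) * z + k * m < n + 1 := by
        have : (((n + 1) * z + k * m : ℤ) : ℝ) < n + 1 := by
          rw [← h1]
          exact mul_lt_of_lt_one_right (by positivity) (hwin _ _)
        exact_mod_cast this
      obtain ⟨N, hN⟩ := Int.eq_ofNat_of_zero_le h2
      refine ⟨⟨N, by omega⟩, ?_, k, rfl, z, ?_⟩
      · simp only [h1, hN]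
        simp
      · push_cast
        linarith
    choose N hN1 k hk hNk using hN
    have hinj : Function.Injective N := by
      intro i j hij
      rw [← hk i, ← hk j, hmod (k i) (k j)]
      have := dvd_sub (hNk j) (hNk i)
      rw [hij] at this
      rwa [show ((N j : ℤ) - k j * m) - (N j - k i * m) = (k i - k j) * m by ring] at this
    have hmono : Monotone N := by
      intro i j hij
      have : (N i : ℝ) ≤ N j := by
        rw [← hN1, ← hN1]
        gcongr
        exact hu hij
      exact_mod_cast this
    have hid : N = id := (hmono.strictMono_of_injective hinj).eq_id
    intro i
    rw [hN1, hid, id]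

end Circle

/-! ### Prime `n + 1` -/

section Prime

variable {ι V N : Type*} [Finite ι] [NormedAddCommGroup V] [InnerProductSpace ℝ V]
  [FiniteDimensional ℝ V]
  [AddCommGroup N] [Module ℝ N] {P : RootPairing ι ℝ V N} [P.IsRootSystem]
  [P.IsCrystallographic] [P.IsReduced] [IsEuclidean P] {b : P.Base} {n : ℕ}

theorem centralizer_le_of_prime {e : b.support ≃ Fin n}
    (he : ∀ i j, b.cartanMatrix i j = CartanMatrix.A n (e i) (e j)) (hn : 1 ≤ n) {i₀ : ι}
    (hi₀ : IsHighestRoot b i₀) (hp : (n + 1).Prime) {x y : V}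
    (hx : x ∈ komrakovPremet b i₀) (hy : y ∈ komrakovPremet b i₀)
    (hxy : regularFace (komrakovPremet b i₀) x = regularFace (komrakovPremet b i₀) y) :
    centralizer (extAffineWeylGroup P) x ≤ centralizer (extAffineWeylGroup P) y := by
  rintro g ⟨hg, hgx⟩
  refine ⟨hg, ?_⟩
  obtain ⟨γ, hγ, w, hgw⟩ := hg
  obtain ⟨σ, hσ⟩ := exists_actsAs_weyl_smul he w
  choose c hc using exists_coord_eq_intCast e hγ
  have hmem := mem_komrakovPremet_iff he hn hi₀
  have hgc : ∀ z i j, coord e i (g z) - coord e j (g z) =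
      c i - c j + (coord e (σ i) z - coord e (σ j) z) := by
    intro z i j
    rw [hgw, map_add, map_add, hc, hc, ← hσ z i j]
    ring
  have hanti : Antitone fun i => coord e i x :=
    Fin.antitone_iff_succ_le.mpr fun k => sub_nonneg.mp ((hmem x).mp hx k).1
  have hlast : coord e 0 x - coord e (Fin.last n) x < 1 := by
    by_contra! hle
    have h1 := fun k => (hmem x).mp hx k
    have h2 : ∀ k : Fin n, coord e k.castSucc x - coord e k.succ x = 0 := fun k => by
      linarith [(h1 k).1, (h1 k).2]
    have h3 := zero_sub_eq_mul_of_castSucc_sub_succ (f := fun i => coord e i x) h2 (Fin.last n)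
    rw [mul_zero] at h3
    linarith
  have hrel : ∀ i, coord e i x = c i + coord e (σ i) x + (-c 0 - coord e (σ 0) x) := by
    intro i
    have h1 := hgc x i 0
    rw [hgx, coord_zero] at h1
    linarith
  rcases trivial_or_equidistant hp hanti hlast hrel with h | h
  · -- The points coincide along the cycles of `σ`; this is a property of the regular face.
    have hwall : ∀ k : Fin n, coord e k.castSucc x = coord e k.succ x →
        coord e k.castSucc y = coord e k.succ y := by
      intro k hk
      have h1 := inner_eq_of_regularFace_eq (v := -P.root (e.symm k)) (c := 0)
        (fun z hz => by
          rw [inner_neg_left, ← coord_castSucc_sub_succ]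
          linarith [((hmem z).mp hz k).1])
        hx (by rw [inner_neg_left, ← coord_castSucc_sub_succ, hk, sub_self, neg_zero]) hy hxy
      rw [inner_neg_left, ← coord_castSucc_sub_succ] at h1
      linarith
    have hle : ∀ i j, i ≤ j → coord e i x = coord e j x → coord e i y = coord e j y := by
      intro i j hij
      induction j using Fin.induction with
      | zero => rw [Fin.le_zero_iff.mp hij]; exact fun _ => rfl
      | succ k ih =>
        intro hik
        rcases hij.eq_or_lt with rfl | hlt
        · rfl
        have hik' : i ≤ k.castSucc := Fin.le_castSucc_iff.mpr hlt
        have h1 : coord e k.castSucc x ≤ coord e i x := hanti hik'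
        have h2 : coord e k.succ x ≤ coord e k.castSucc x := hanti k.castSucc_lt_succ.le
        rw [ih hik' (by linarith), hwall k (by linarith)]
    have hy' : ∀ i, coord e (σ i) y = coord e i y := by
      intro i
      rcases le_total i (σ i) with hi | hi
      · exact (hle _ _ hi (h i).1).symm
      · exact hle _ _ hi (h i).1.symm
    refine eq_of_coord_sub_eq e fun i j => ?_
    rw [hgc, hy', hy']
    linarith [(h i).2, (h j).2]
  · -- The point `x` is the barycentre of the alcove, which is alone in its regular face.
    have hn0 : (n + 1 : ℝ) ≠ 0 := by positivity
    have hx' : ∀ i : Fin (n + 1), coord e 0 x - coord e i x = i / (n + 1) := fun i => by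
      rw [eq_div_iff hn0, mul_comm]
      exact h i
    have htop : ∀ k : Fin n, coord e 0 y - coord e (Fin.last n) y +
        (coord e k.castSucc y - coord e k.succ y) = 1 := by
      intro k
      have h1 := inner_eq_of_regularFace_eq (v := P.root i₀ + P.root (e.symm k)) (c := 1)
        (fun z hz => by
          rw [inner_add_left, inner_highestRoot he hn hi₀, ← coord_castSucc_sub_succ]
          exact ((hmem z).mp hz k).2)
        hx (by
          rw [inner_add_left, inner_highestRoot he hn hi₀, ← coord_castSucc_sub_succ,
            ← sub_sub_sub_cancel_left (coord e k.succ x) (coord e k.castSucc x) (coord e 0 x),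
            hx', hx', hx', Fin.val_last, Fin.val_succ, Fin.val_castSucc]
          push_cast
          field_simp
          ring) hy hxy
      rwa [inner_add_left, inner_highestRoot he hn hi₀, ← coord_castSucc_sub_succ] at h1
    have hstep : ∀ k : Fin n, coord e k.castSucc y - coord e k.succ y =
        1 - (coord e 0 y - coord e (Fin.last n) y) := fun k => by linarith [htop k]
    have hy' := zero_sub_eq_mul_of_castSucc_sub_succ (f := fun i => coord e i y) hstep
    have hδ : 1 - (coord e 0 y - coord e (Fin.last n) y) = 1 / (n + 1) := by
      have := hy' (Fin.last n)
      rw [Fin.val_last] at this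
      rw [eq_div_iff hn0]
      linarith
    rw [hδ] at hy'
    have hyx : y = x := by
      refine eq_of_coord_sub_eq e fun i j => ?_
      have h1 := hy' i
      have h2 := hy' j
      have h3 := hx' i
      have h4 := hx' j
      rw [div_eq_mul_one_div] at h3 h4
      linarith
    rw [hyx, hgx]

end Prime

/-! ### Composite `n + 1` -/

section Staircase

/-- The sequence whose downward steps `i → i + 1` are `2c` if `a` divides `i + 1` and `c` otherwise,
where `c = 1 / (m (a + 1))` is chosen so that `a m` consecutive steps add up to `1`. -/
noncomputable def staircase (a m i : ℕ) : ℝ :=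
  -((i + (i / a : ℕ)) * (1 / (m * (a + 1))))

theorem staircase_sub_succ (a m i : ℕ) :
    staircase a m i - staircase a m (i + 1) =
      (if a ∣ i + 1 then 2 else 1) * (1 / (m * (a + 1))) := by
  rw [staircase, staircase, Nat.succ_div]
  split_ifs <;> push_cast <;> ring

theorem staircase_sub_add {a m : ℕ} (ha : 0 < a) (hm : 0 < m) (i k : ℕ) :
    staircase a m i - staircase a m (i + a * k) = k / m := by
  rw [staircase, staircase, Nat.add_mul_div_left i k ha]
  have : (m : ℝ) ≠ 0 := by positivity
  push_cast
  field_simp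
  ring

/-- The steps of the staircase have period `a`, and the staircase drops by `1` over `a m` steps, so
that modulo `1` the cyclic rotation by `a` acts on its first `a m` values as a translation. -/
theorem exists_staircase_sub_rotate {a m : ℕ} (ha : 0 < a) (hm : 0 < m) {i : ℕ} (hi : i < a * m) :
    ∃ z : ℤ, staircase a m i - staircase a m ((i + a) % (a * m)) = 1 / m + z := by
  have h1 := staircase_sub_add ha hm i 1
  rw [mul_one, Nat.cast_one] at h1
  rcases lt_or_ge (i + a) (a * m) with h | h
  · exact ⟨0, by rw [Nat.mod_eq_of_lt h, h1]; simp⟩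
  · have ham : a ≤ a * m := Nat.le_mul_of_pos_right a hm
    rw [Nat.mod_eq_sub_mod h, Nat.mod_eq_of_lt (by omega)]
    have h2 := staircase_sub_add ha hm (i + a - a * m) m
    rw [Nat.sub_add_cancel h, div_self (by positivity)] at h2
    exact ⟨-1, by push_cast; linarith⟩

/-- A perturbation changing the steps `0 → 1` and `a → a + 1` by opposite amounts. -/
noncomputable def bump (a m i : ℕ) : ℝ :=
  if 0 < i ∧ i ≤ a then -(1 / (m * (a + 1)) / 4) else 0

theorem bump_sub_succ {a : ℕ} (ha : 0 < a) (m i : ℕ) :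
    bump a m i - bump a m (i + 1) =
      (if i = 0 then 1 else if i = a then -1 else 0) * (1 / (m * (a + 1)) / 4) := by
  have h1 : (0 < i ∧ i ≤ a) ↔ (i ≠ 0 ∧ i ≤ a) := by omega
  have h2 : (0 < i + 1 ∧ i + 1 ≤ a) ↔ i + 1 ≤ a := by omega
  simp only [bump, h1, h2]
  rcases Nat.eq_zero_or_pos i with rfl | hi
  · have : 1 ≤ a := ha
    simp [this]
  · have h0 : i ≠ 0 := hi.ne'
    rcases lt_trichotomy i a with h | rfl | h
    · simp [h0, h.le, h.ne, Nat.succ_le_of_lt h]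
    · simp [h0]
    · simp [h0, h.ne', not_le.mpr h, not_le.mpr (h.trans (Nat.lt_succ_self i))]

end Staircase

section Composite

variable {ι V N : Type*} [NormedAddCommGroup V] [InnerProductSpace ℝ V]
  [AddCommGroup N] [Module ℝ N] {P : RootPairing ι ℝ V N} [IsEuclidean P]

theorem exists_mem_extAffineWeylGroup {γ : V} (hγ : γ ∈ coweightLattice P) (w : P.weylGroup) :
    ∃ g ∈ extAffineWeylGroup P, ∀ x, g x = γ + w • x := by
  let l : V ≃ₗᵢ[ℝ] V := (DistribMulAction.toLinearEquiv ℝ V w).isometryOfInner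
    (inner_weyl_smul P w)
  let g : V ≃ᵃⁱ[ℝ] V := l.toAffineIsometryEquiv.trans (AffineIsometryEquiv.constVAdd ℝ V γ)
  have hg : ∀ x, g x = γ + w • x := fun x => rfl
  exact ⟨g, ⟨γ, hγ, w, hg⟩, hg⟩

variable [Finite ι] [FiniteDimensional ℝ V] [P.IsRootSystem]
  [P.IsCrystallographic] [P.IsReduced] {b : P.Base} {n : ℕ}

/-- If `n + 1 = a m` is a proper factorization, the point `x` given by the staircase is fixed by a
rigid motion inducing the rotation of the alcove by `a` steps. A small perturbation of `x` in the
relative interior of its regular face destroys the periodicity. -/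
theorem not_hasStratifiedCentralizers_of_mul {e : b.support ≃ Fin n}
    (he : ∀ i j, b.cartanMatrix i j = CartanMatrix.A n (e i) (e j)) {i₀ : ι}
    (hi₀ : IsHighestRoot b i₀) {a m : ℕ} (ha : 2 ≤ a) (hm : 2 ≤ m) (hn : n + 1 = a * m) :
    ¬ HasStratifiedCentralizers (extAffineWeylGroup P) (komrakovPremet b i₀) := by
  intro H
  have ham : a * 2 ≤ n + 1 := hn ▸ Nat.mul_le_mul_left a hm
  obtain ⟨x, hx⟩ := exists_coord_sub_eq e fun i : Fin (n + 1) => staircase a m i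
  obtain ⟨z, hz⟩ := exists_coord_sub_eq e fun i : Fin (n + 1) => bump a m i
  have hc : (0 : ℝ) < 1 / (m * (a + 1)) := by positivity
  have hmem : ∀ s : ℝ, -1 ≤ s → s ≤ 2 → x + s • z ∈ komrakovPremet b i₀ := by
    intro s hs₁ hs₂
    rw [mem_komrakovPremet_iff he (by omega) hi₀]
    intro k
    have hlast : staircase a m 0 - staircase a m n = 1 - 2 * (1 / (m * (a + 1))) := by
      have h1 := staircase_sub_add (a := a) (m := m) (by omega) (by omega) 0 m
      have h2 := staircase_sub_succ a m n
      rw [if_pos ⟨m, hn⟩] at h2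
      rw [zero_add, ← hn, div_self (by positivity)] at h1
      linarith
    have hlast' : bump a m 0 - bump a m n = 0 := by
      have h : ¬ n ≤ a := by omega
      simp [bump, h]
    have h1 : coord e k.castSucc (x + s • z) - coord e k.succ (x + s • z) =
        (staircase a m k - staircase a m (k + 1)) + s * (bump a m k - bump a m (k + 1)) := by
      have h1 := hx k.castSucc k.succ
      have h2 := hz k.castSucc k.succ
      simp only [Fin.val_castSucc, Fin.val_succ] at h1 h2
      rw [← h1, ← h2]
      simp only [map_add, map_smul, smul_eq_mul]
      ring
    have h2 : coord e 0 (x + s • z) - coord e (Fin.last n) (x + s • z) =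
        1 - 2 * (1 / (m * (a + 1))) := by
      have h1 := hx 0 (Fin.last n)
      have h2 := hz 0 (Fin.last n)
      simp only [Fin.val_zero, Fin.val_last, hlast, hlast'] at h1 h2
      rw [← h1]
      simp only [map_add, map_smul, smul_eq_mul]
      linear_combination s * h2
    rw [h1, h2, staircase_sub_succ, bump_sub_succ (by omega)]
    generalize (1 : ℝ) / (m * (a + 1)) = c at hc
    by_cases hk : a ∣ (k : ℕ) + 1
    · -- The perturbed steps, ending at `1` and `a + 1`, do not end at multiples of `a`.
      have hk0 : (k : ℕ) ≠ 0 := fun h => by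
        rw [h] at hk
        have := Nat.le_of_dvd one_pos hk
        omega
      have hka : (k : ℕ) ≠ a := fun h => by
        rw [h] at hk
        have := Nat.le_of_dvd one_pos ((Nat.dvd_add_right (dvd_refl a)).mp hk)
        omega
      rw [if_pos hk, if_neg hk0, if_neg hka]
      constructor <;> linarith
    · rw [if_neg hk]
      split_ifs <;> constructor <;> nlinarith
  have hface := regularFace_eq_of_mem (F := komrakovPremet b i₀) (x := x) (z := z)
    (by simpa [sub_eq_add_neg] using hmem (-1) le_rfl (by norm_num))
    (by simpa using hmem 0 (by norm_num) (by norm_num))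
    (by simpa using hmem 1 (by norm_num) (by norm_num))
    (by simpa [two_smul, add_assoc] using hmem 2 (by norm_num) le_rfl)
  have hcent := H x (by simpa using hmem 0 (by norm_num) (by norm_num)) (x + z)
    (by simpa using hmem 1 (by norm_num) (by norm_num)) hface
  let r : Fin (n + 1) := ⟨a, by omega⟩
  obtain ⟨w, hw⟩ := exists_weyl_smul_actsAs he (Equiv.addRight r)
  have hγ : x - w • x ∈ coweightLattice P := by
    refine mem_coweightLattice_of_coord_sub he fun i j => ?_
    have hrot : ∀ i : Fin (n + 1), ∃ k : ℤ,
        staircase a m i - staircase a m (i + r : Fin (n + 1)) = 1 / m + k := fun i => by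
      have h := exists_staircase_sub_rotate (a := a) (m := m) (i := i) (by omega) (by omega)
        (hn ▸ i.isLt)
      rw [← hn] at h
      rw [Fin.val_add]
      exact h
    obtain ⟨k, hk⟩ := hrot i
    obtain ⟨l, hl⟩ := hrot j
    refine ⟨k - l, ?_⟩
    have h1 := hw x i j
    rw [Equiv.coe_addRight, hx] at h1
    rw [map_sub, map_sub, sub_sub_sub_comm, hx, h1]
    push_cast
    linarith
  obtain ⟨g, hg, hgx⟩ := exists_mem_extAffineWeylGroup hγ w
  have hfix : g ∈ centralizer (extAffineWeylGroup P) x := ⟨hg, by rw [hgx, sub_add_cancel]⟩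
  rw [hcent] at hfix
  have hwz : w • z = z := by
    have h := hfix.2
    rw [hgx, smul_add] at h
    have : x + w • z = x + z := by rw [← h]; abel
    exact add_left_cancel this
  -- Rotation by `a` would carry the step `0 → 1` of `z` to its step `a → a + 1`.
  let s : Fin (n + 1) := ⟨1, by omega⟩
  have h := hw z 0 s
  have hs : ((s + r : Fin (n + 1)) : ℕ) = a + 1 := by
    rw [Fin.val_add, Nat.mod_eq_of_lt] <;> simp only [s, r] <;> omega
  have h0 := bump_sub_succ (a := a) (by omega) m 0
  have h1 := bump_sub_succ (a := a) (by omega) m a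
  rw [if_pos rfl] at h0
  rw [if_neg (by omega), if_pos rfl] at h1
  simp only [hwz, Equiv.coe_addRight, zero_add, hz, hs] at h
  simp only [s, r, Fin.val_zero] at h
  rw [zero_add] at h0
  linarith

end Composite

end StratCent

theorem mainTheorem8 {ι V N : Type*} [Finite ι]
    [NormedAddCommGroup V] [InnerProductSpace ℝ V] [FiniteDimensional ℝ V]
    [AddCommGroup N] [Module ℝ N]
    (P : RootPairing ι ℝ V N) [P.IsRootSystem] [P.IsCrystallographic] [P.IsReduced]
    [StratCent.IsEuclidean P]
    (b : P.Base) (n : ℕ) (hn : 1 ≤ n) (hA : StratCent.IsTypeA b n)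
    (i₀ : ι) (hi₀ : StratCent.IsHighestRoot b i₀) :
    StratCent.HasStratifiedCentralizers (StratCent.extAffineWeylGroup P)
        (StratCent.komrakovPremet b i₀) ↔
      Nat.Prime (n + 1) := by
  obtain ⟨e, he⟩ := hA
  constructor
  · intro H
    by_contra hp
    obtain ⟨a, m, ha, hm, h⟩ := (Nat.not_prime_iff_exists_mul_eq (by omega)).mp hp
    exact StratCent.not_hasStratifiedCentralizers_of_mul he hi₀
      (by by_contra; interval_cases a <;> omega) (by by_contra; interval_cases m <;> omega) h.symm H
  · intro hp x hx y hy hxy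
    exact le_antisymm (StratCent.centralizer_le_of_prime he hn hi₀ hp hx hy hxy)
      (StratCent.centralizer_le_of_prime he hn hi₀ hp hy hx hxy.symm)
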